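/- Let $\mathcal A,\mathcal B$ be commutative unital C*-algebras. A *(not necessarily full) imprimitivity Hilbert C*-bimodule* ${}_{\mathcal A}\mathcal M_{\mathcal B}$ is a complex vector space $\mathcal M$ that is a unital left $\mathcal A$-, right $\mathcal B$-bimodule with compatible scalar multiplications, with a (positive definite) left $\mathcal A$-valued inner product ${}_{\mathcal A}\langle x,y\rangle$, $\mathcal A$-linear in $x$, and a (positive definite) right $\mathcal B$-valued inner product $\langle x,y\rangle_{\mathcal B}$, $\mathcal B$-linear in $y$, such that ${}_{\mathcal A}\langle x,y\rangle\, z=x\,\langle y,z\rangle_{\mathcal B}$ for all $x,y,z\in\mathcal M$, and such that $\mathcal M$ is complete for $\|{}_{\mathcal A}\langle x,x\rangle\|^{1/2}$ and for $\|\langle x,x\rangle_{\mathcal B}\|^{1/2}$. Neither inner product is assumed to be full. Given such an $\mathcal M$, let $\mathcal X\subseteq \mathrm{Sp}(\mathcal A)\times\mathrm{Sp}(\mathcal B)$, with the subspace topology, be the set of the pairs $(\chi,\psi)$ of characters for which there is a nonzero linear functional $\omega:\mathcal M\to\mathbb C$ with $$\omega(ax)=\chi(a)\omega(x),\quad \omega(xb)=\omega(x)\psi(b),\quad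 \chi({}_{\mathcal A}\langle x,y\rangle)=\omega(x)\overline{\omega(y)},\quad \psi(\langle x,y\rangle_{\mathcal B})=\overline{\omega(x)}\,\omega(y)$$ for all $a\in\mathcal A$, $b\in\mathcal B$, $x,y\in\mathcal M$ (equivalently: $(\chi,\omega,\psi)$ is a $*$-functor to $\mathbb C$, nonzero on $\mathcal M$, on the linking C*-category of $\mathcal M$). For $p=(\chi,\psi)\in\mathcal X$ let $\mathcal E_p:=\mathcal M/\{x:\chi({}_{\mathcal A}\langle x,x\rangle)=0\}=\mathcal M/\ker\omega$, with the inner product induced by $\chi({}_{\mathcal A}\langle x,y\rangle)$ and the corresponding norm, and for $x\in\mathcal M$ let $\hat x(p)\in\mathcal E_p$ be the class of $x$. Give $\mathcal E:=\biguplus_{p\in\mathcal X}\mathcal E_p$ the topology generated by the tubes $\{e\in\mathcal E_p : p\in O,\ \|e-\hat x(p)\|<\epsilon\}$ with $x\in\mathcal M$, $\epsilon>0$, $O\subseteq\mathcal X$ open. **Theorem.** For every such $\mathcal M$: 1. $\mathcal X$ is the graph of a homeomorphism from an open subset of $\mathrm{Sp}(\mathcal A)$ onto an open subset of $\mathrm{Sp}(\mathcal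 B)$, and it is a locally compact Hausdorff space. 2. $\mathcal E\to\mathcal X$ is a (locally trivial) complex line bundle, and its norm is a continuous function on $\mathcal E$. 3. The continuous sections of $\mathcal E$ vanishing at infinity, $\Gamma_o(\mathcal E)$, with the actions $(a\sigma b)(\chi,\psi)=\chi(a)\psi(b)\,\sigma(\chi,\psi)$, form an imprimitivity Hilbert C*-bimodule over $\mathcal A,\mathcal B$ with the pointwise inner products: if $\langle e,f\rangle_p$ denotes the inner product of $\mathcal E_p$, linear in $e$, then for $p=(\chi,\psi)\in\mathcal X$, $\chi({}_{\mathcal A}\langle\sigma,\tau\rangle)=\langle\sigma(p),\tau(p)\rangle_p$ and $\psi(\langle\sigma,\tau\rangle_{\mathcal B})=\langle\tau(p),\sigma(p)\rangle_p$, while the characters of $\mathcal A$ (resp. $\mathcal B$) outside the projection of $\mathcal X$ vanish on ${}_{\mathcal A}\langle\sigma,\tau\rangle$ (resp. $\langle\sigma,\tau\rangle_{\mathcal B}$). 4. The map $x\mapsto\hat x$ is an isomorphism from $\mathcal M$ onto $\Gamma_o(\mathcal E)$ of imprimitivity Hilbert C*-bimodules: it is a linear bijection and preserves both actions and both inner products.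 -/

import Mathlib

open Bundle Topology Filter
open scoped ComplexOrder InnerProductSpace

noncomputable section

/-- Every sequence which is Cauchy for `N` converges for `N` (used for functions `N` which turn
out to be norms, so that this is completeness). -/
def IsSeqComplete {M : Type*} [AddCommGroup M] (N : M → ℝ) : Prop :=
  ∀ u : ℕ → M,
    (∀ ε : ℝ, 0 < ε → ∃ n₀ : ℕ, ∀ m, n₀ ≤ m → ∀ n, n₀ ≤ n → N (u m - u n) < ε) →
    ∃ x : M, ∀ ε : ℝ, 0 < ε → ∃ n₀ : ℕ, ∀ n, n₀ ≤ n → N (u n - x) < ε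

/-- A (not necessarily full) imprimitivity Hilbert C*-bimodule `M` over commutative unital
C*-algebras `A` (acting on the left) and `B` (acting on the right, i.e. as `Bᵐᵒᵖ`).
`left x y` is the `A`-valued inner product (linear in `x`), `right x y` the `B`-valued one
(linear in `y`). Neither inner product is assumed to be full. -/
structure ImprimitivityBimodule (A B M : Type*)
    [CommCStarAlgebra A] [PartialOrder A] [StarOrderedRing A]
    [CommCStarAlgebra B] [PartialOrder B] [StarOrderedRing B]
    [AddCommGroup M] [Module ℂ M] [Module A M] [Module Bᵐᵒᵖ M]
    [IsScalarTower ℂ A M] [IsScalarTower ℂ Bᵐᵒᵖ M] [SMulCommClass A Bᵐᵒᵖ M] where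
  left : M → M → A
  left_add : ∀ x y z, left (x + y) z = left x z + left y z
  left_smul : ∀ (a : A) (x y), left (a • x) y = a * left x y
  left_star : ∀ x y, star (left x y) = left y x
  left_nonneg : ∀ x, 0 ≤ left x x
  left_definite : ∀ x, left x x = 0 → x = 0
  right : M → M → B
  right_add : ∀ x y z, right x (y + z) = right x y + right x z
  right_smul : ∀ (b : B) (x y), right x (MulOpposite.op b • y) = right x y * b
  right_star : ∀ x y, star (right x y) = right y x
  right_nonneg : ∀ x, 0 ≤ right x x
  right_definite : ∀ x, right x x = 0 → x = 0
  /-- `⟨x, y⟩_A · z = x · ⟨y, z⟩_B` -/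
  imprimitivity : ∀ x y z, left x y • z = MulOpposite.op (right y z) • x
  left_complete : IsSeqComplete fun x => √‖left x x‖
  right_complete : IsSeqComplete fun x => √‖right x x‖

namespace ImprimitivityBimodule

variable {A B M N : Type*}
  [CommCStarAlgebra A] [PartialOrder A] [StarOrderedRing A]
  [CommCStarAlgebra B] [PartialOrder B] [StarOrderedRing B]
  [AddCommGroup M] [Module ℂ M] [Module A M] [Module Bᵐᵒᵖ M]
  [IsScalarTower ℂ A M] [IsScalarTower ℂ Bᵐᵒᵖ M] [SMulCommClass A Bᵐᵒᵖ M]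
  [AddCommGroup N] [Module ℂ N] [Module A N] [Module Bᵐᵒᵖ N]
  [IsScalarTower ℂ A N] [IsScalarTower ℂ Bᵐᵒᵖ N] [SMulCommClass A Bᵐᵒᵖ N]

/-- An isomorphism of imprimitivity Hilbert C*-bimodules: a linear bijection which respects both
actions and both inner products. -/
structure Iso (S : ImprimitivityBimodule A B M) (T : ImprimitivityBimodule A B N)
    extends M ≃ₗ[ℂ] N where
  map_left_smul : ∀ (a : A) (x : M), toFun (a • x) = a • toFun x
  map_right_smul : ∀ (b : B) (x : M),
    toFun (MulOpposite.op b • x) = MulOpposite.op b • toFun x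
  left_map : ∀ x y : M, T.left (toFun x) (toFun y) = S.left x y
  right_map : ∀ x y : M, T.right (toFun x) (toFun y) = S.right x y

variable (S : ImprimitivityBimodule A B M)

/-- A `*`-functor from the linking C*-category of `M` (two objects, endomorphism algebras `A` and
`B`, off-diagonal Hom-sets `M` and its dual `M*`, with `x ∘ y* = ⟨x, y⟩_A`, `x* ∘ y = ⟨x, y⟩_B`)
to `ℂ`. Its restriction to `M*` is `x* ↦ conj (onM x)`. -/
structure LinkingFunctor where
  onA : WeakDual.characterSpace ℂ A
  onB : WeakDual.characterSpace ℂ B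
  onM : M →ₗ[ℂ] ℂ
  map_left_smul : ∀ (a : A) (x : M), onM (a • x) = onA a * onM x
  map_right_smul : ∀ (b : B) (x : M), onM (MulOpposite.op b • x) = onM x * onB b
  map_left : ∀ x y : M, onA (S.left x y) = onM x * star (onM y)
  map_right : ∀ x y : M, onB (S.right x y) = star (onM x) * onM y

/-- The base space: the pairs `(χ, ψ)` of characters of `A` and `B` which are the diagonal
restrictions of a `*`-functor on the linking category that does not vanish on `M`, with the
topology of a subspace of `Sp(A) × Sp(B)`. -/
def graph : Set (WeakDual.characterSpace ℂ A × WeakDual.characterSpace ℂ B) :=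
  {p | ∃ ω : S.LinkingFunctor, ω.onA = p.1 ∧ ω.onB = p.2 ∧ ω.onM ≠ 0}

variable {S}

/-- `M`, with the semi-inner product `(x, y) ↦ χ(⟨y, x⟩_A)` at a point `p = (χ, ψ)`. -/
def PreFiber (_p : S.graph) : Type _ := M

instance (p : S.graph) : AddCommGroup (PreFiber p) := inferInstanceAs (AddCommGroup M)

instance (p : S.graph) : Module ℂ (PreFiber p) := inferInstanceAs (Module ℂ M)

lemma left_complex_smul (c : ℂ) (x y : M) : S.left (c • x) y = c • S.left x y := by
  have h : c • x = (c • (1 : A)) • x := by rw [smul_assoc, one_smul]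
  rw [h, S.left_smul, smul_mul_assoc, one_mul]

/-- The semi-inner product on `M` at `p = (χ, ψ)`. -/
@[reducible] def preCore (p : S.graph) : PreInnerProductSpace.Core ℂ M where
  inner x y := p.1.1 (S.left y x)
  conj_inner_symm x y := by
    change star (p.1.1 (S.left x y)) = p.1.1 (S.left y x)
    rw [← map_star, S.left_star]
  re_inner_nonneg x := by
    change 0 ≤ (p.1.1 (S.left x x)).re
    obtain ⟨a, ha⟩ := CStarAlgebra.nonneg_iff_eq_star_mul_self.mp (S.left_nonneg x)
    rw [ha, map_mul, map_star]
    exact (Complex.nonneg_iff.mp (star_mul_self_nonneg _)).1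
  add_left x y z := by
    change p.1.1 (S.left z (x + y)) = p.1.1 (S.left z x) + p.1.1 (S.left z y)
    rw [← S.left_star, S.left_add, star_add, S.left_star, S.left_star, map_add]
  smul_left x y c := by
    change p.1.1 (S.left y (c • x)) = star c * p.1.1 (S.left y x)
    rw [← S.left_star, left_complex_smul, star_smul, S.left_star, map_smul, smul_eq_mul]

instance (p : S.graph) : SeminormedAddCommGroup (PreFiber p) :=
  @InnerProductSpace.Core.toSeminormedAddCommGroup ℂ M _ _ _ (preCore p)

instance (p : S.graph) : InnerProductSpace ℂ (PreFiber p) :=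
  InnerProductSpace.ofCore (F := M) (preCore p)

variable (S)

/-- The fibre over `p = (χ, ψ)`: the quotient of `M` by the null space of `χ(⟨x, x⟩_A)`. As
`χ(⟨x, y⟩_A) = ω(x) conj ω(y)` for each `*`-functor `ω` over `p`, it is the quotient of `M` by
the kernel of `ω`, with inner product `(f, e) ↦ e ∘ f*` and norm `‖e‖² = ‖e ∘ e*‖`. -/
def Fiber (p : S.graph) : Type _ := SeparationQuotient (PreFiber p)

instance (p : S.graph) : NormedAddCommGroup (S.Fiber p) :=
  inferInstanceAs (NormedAddCommGroup (SeparationQuotient (PreFiber p)))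

instance (p : S.graph) : InnerProductSpace ℂ (S.Fiber p) :=
  inferInstanceAs (InnerProductSpace ℂ (SeparationQuotient (PreFiber p)))

/-- The Gel'fand transform of `x : M`, as a section: at `p` it is the class of `x`. -/
def gelfand (x : M) (p : S.graph) : S.Fiber p :=
  show SeparationQuotient (PreFiber p) from SeparationQuotient.mk (show PreFiber p from x)

/-- The tube of radius `ε` over `O` around the Gel'fand transform of `x`. -/
def tube (x : M) (ε : ℝ) (O : Set S.graph) : Set (TotalSpace ℂ S.Fiber) :=
  {e : TotalSpace ℂ S.Fiber | e.proj ∈ O ∧ ‖e.snd - S.gelfand x e.proj‖ < ε}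

/-- The total space carries the tubular topology given by the Gel'fand transforms. -/
instance : TopologicalSpace (TotalSpace ℂ S.Fiber) :=
  TopologicalSpace.generateFrom
    {U | ∃ (x : M) (ε : ℝ) (O : Set S.graph), 0 < ε ∧ IsOpen O ∧ U = S.tube x ε O}

variable {S}

lemma gelfand_add (x y : M) (p : S.graph) :
    S.gelfand (x + y) p = S.gelfand x p + S.gelfand y p := rfl

lemma gelfand_sub (x y : M) (p : S.graph) :
    S.gelfand (x - y) p = S.gelfand x p - S.gelfand y p := rfl

lemma gelfand_smul (c : ℂ) (x : M) (p : S.graph) :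
    S.gelfand (c • x) p = c • S.gelfand x p := rfl

lemma gelfand_surjective (p : S.graph) (e : S.Fiber p) : ∃ x, S.gelfand x p = e :=
  SeparationQuotient.surjective_mk (X := PreFiber p) e

lemma norm_gelfand (x : M) (p : S.graph) :
    ‖S.gelfand x p‖ = √(p.1.1 (S.left x x)).re := rfl

lemma inner_gelfand (x y : M) (p : S.graph) :
    ⟪S.gelfand x p, S.gelfand y p⟫_ℂ = p.1.1 (S.left y x) := rfl

lemma continuous_onA (a : A) : Continuous fun p : S.graph => p.1.1 a :=
  (WeakDual.eval_continuous a).comp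
    (continuous_subtype_val.comp (continuous_fst.comp continuous_subtype_val))

lemma continuous_onB (b : B) : Continuous fun p : S.graph => p.1.2 b :=
  (WeakDual.eval_continuous b).comp
    (continuous_subtype_val.comp (continuous_snd.comp continuous_subtype_val))

lemma continuous_norm_gelfand (x : M) : Continuous fun p : S.graph => ‖S.gelfand x p‖ := by
  simp only [norm_gelfand]
  exact Real.continuous_sqrt.comp (Complex.continuous_re.comp (continuous_onA _))

/-- A section is continuous iff its distance to each Gel'fand transform is upper
semicontinuous. -/
lemma continuous_section_iff (σ : ∀ p, S.Fiber p) :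
    Continuous (fun p => TotalSpace.mk' ℂ p (σ p)) ↔
      ∀ (x : M) (ε : ℝ), IsOpen {p | ‖σ p - S.gelfand x p‖ < ε} := by
  rw [continuous_generateFrom_iff]
  constructor
  · intro h x ε
    by_cases hε : 0 < ε
    · convert h _ ⟨x, ε, Set.univ, hε, isOpen_univ, rfl⟩
      ext p
      simp [tube]
    · convert isOpen_empty
      ext p
      simpa using (not_lt.mp hε).trans (norm_nonneg _)
  · rintro h _ ⟨x, ε, O, -, hO, rfl⟩
    exact hO.inter (h x ε)

lemma continuous_comb (f g : S.graph → ℂ) (hf : Continuous f) (hg : Continuous g)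
    (σ τ : ∀ p, S.Fiber p)
    (hσ : Continuous (fun p => TotalSpace.mk' ℂ p (σ p)))
    (hτ : Continuous (fun p => TotalSpace.mk' ℂ p (τ p))) :
    Continuous (fun p => TotalSpace.mk' ℂ p (f p • σ p + g p • τ p)) := by
  rw [continuous_section_iff] at *
  intro x ε
  rw [isOpen_iff_mem_nhds]
  intro p₀ hp₀
  obtain ⟨y, hy⟩ := gelfand_surjective p₀ (σ p₀)
  obtain ⟨z, hz⟩ := gelfand_surjective p₀ (τ p₀)
  set w : M := f p₀ • y + g p₀ • z - x with hw
  have hw0 : ‖S.gelfand w p₀‖ < ε := by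
    rw [hw, gelfand_sub, gelfand_add, gelfand_smul, gelfand_smul, hy, hz]
    exact hp₀
  set δ : ℝ := (ε - ‖S.gelfand w p₀‖) / 2 with hδ
  have hδ0 : 0 < δ := by rw [hδ]; linarith
  set C : ℝ := ‖f p₀‖ + ‖g p₀‖ + 2 with hC
  have hC0 : 0 < C := by positivity
  have e1 := (hσ y (δ / (2 * C))).mem_nhds (x := p₀)
    (by
      change ‖σ p₀ - S.gelfand y p₀‖ < _
      rw [hy, sub_self, norm_zero]
      positivity)
  have e2 := (hτ z (δ / (2 * C))).mem_nhds (x := p₀)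
    (by
      change ‖τ p₀ - S.gelfand z p₀‖ < _
      rw [hz, sub_self, norm_zero]
      positivity)
  have c3 : Continuous fun p => ‖f p - f p₀‖ * ‖S.gelfand y p‖
      + ‖g p - g p₀‖ * ‖S.gelfand z p‖ + ‖S.gelfand w p‖ :=
    (((hf.sub continuous_const).norm.mul (continuous_norm_gelfand y)).add
      ((hg.sub continuous_const).norm.mul (continuous_norm_gelfand z))).add
      (continuous_norm_gelfand w)
  have e3 := (isOpen_lt c3 (continuous_const (y := ‖S.gelfand w p₀‖ + δ))).mem_nhds (x := p₀)
    (by simpa using hδ0)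
  have e4 := (isOpen_lt hf.norm (continuous_const (y := C))).mem_nhds (x := p₀)
    (by change ‖f p₀‖ < C; have := norm_nonneg (g p₀); linarith)
  have e5 := (isOpen_lt hg.norm (continuous_const (y := C))).mem_nhds (x := p₀)
    (by change ‖g p₀‖ < C; have := norm_nonneg (f p₀); linarith)
  filter_upwards [e1, e2, e3, e4, e5] with p h1 h2 h3 h4 h5
  replace h1 : ‖σ p - S.gelfand y p‖ < δ / (2 * C) := h1
  replace h2 : ‖τ p - S.gelfand z p‖ < δ / (2 * C) := h2
  replace h4 : ‖f p‖ < C := h4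
  replace h5 : ‖g p‖ < C := h5
  change ‖f p • σ p + g p • τ p - S.gelfand x p‖ < ε
  have key : f p • σ p + g p • τ p - S.gelfand x p =
      f p • (σ p - S.gelfand y p) + g p • (τ p - S.gelfand z p)
      + ((f p - f p₀) • S.gelfand y p + (g p - g p₀) • S.gelfand z p + S.gelfand w p) := by
    rw [hw, gelfand_sub, gelfand_add, gelfand_smul, gelfand_smul]
    simp only [smul_sub, sub_smul]
    abel
  have b1 : ‖f p • (σ p - S.gelfand y p)‖ ≤ C * (δ / (2 * C)) := by
    rw [norm_smul]; gcongr
  have b2 : ‖g p • (τ p - S.gelfand z p)‖ ≤ C * (δ / (2 * C)) := by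
    rw [norm_smul]; gcongr
  have b3 : ‖(f p - f p₀) • S.gelfand y p + (g p - g p₀) • S.gelfand z p + S.gelfand w p‖
      < ‖S.gelfand w p₀‖ + δ := by
    refine lt_of_le_of_lt (norm_add₃_le) ?_
    rw [norm_smul, norm_smul]
    exact h3
  have hCC : C * (δ / (2 * C)) = δ / 2 := by field_simp
  rw [key]
  calc _ ≤ _ := norm_add₃_le
    _ < ε := by rw [hCC] at b1 b2; linarith

lemma continuous_zero_section :
    Continuous (fun p => TotalSpace.mk' ℂ p (0 : S.Fiber p)) := by
  rw [continuous_section_iff]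
  intro x ε
  simp only [zero_sub, norm_neg]
  exact isOpen_lt (continuous_norm_gelfand x) continuous_const

/-- The continuous sections vanishing at infinity. -/
def sections₀ (S : ImprimitivityBimodule A B M) : Submodule ℂ (∀ p, S.Fiber p) where
  carrier := {σ | Continuous (fun p => TotalSpace.mk' ℂ p (σ p)) ∧
    Tendsto (fun p => ‖σ p‖) (cocompact S.graph) (𝓝 0)}
  zero_mem' := ⟨continuous_zero_section, by simpa using tendsto_const_nhds⟩
  add_mem' {σ τ} hσ hτ := by
    have h := continuous_comb (fun _ => 1) (fun _ => 1) continuous_const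
      continuous_const σ τ hσ.1 hτ.1
    refine ⟨by simpa using h, ?_⟩
    refine squeeze_zero (fun p => norm_nonneg _) (fun p => norm_add_le (σ p) (τ p)) ?_
    simpa using hσ.2.add hτ.2
  smul_mem' c σ hσ := by
    have h := continuous_comb (fun _ => c) (fun _ => 0) continuous_const
      continuous_const σ σ hσ.1 hσ.1
    refine ⟨by simpa using h, ?_⟩
    simpa [norm_smul] using hσ.2.const_mul ‖c‖

lemma smul_mem_sections₀ (f : S.graph → ℂ) (hf : Continuous f) (C : ℝ) (hC : ∀ p, ‖f p‖ ≤ C)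
    {σ : ∀ p, S.Fiber p} (hσ : σ ∈ S.sections₀) : (fun p => f p • σ p) ∈ S.sections₀ := by
  refine ⟨by simpa using continuous_comb f (fun _ => 0) hf continuous_const σ σ hσ.1 hσ.1, ?_⟩
  refine squeeze_zero (fun p => norm_nonneg _) (g := fun p => C * ‖σ p‖) (fun p => ?_) ?_
  · rw [norm_smul]
    exact mul_le_mul_of_nonneg_right (hC p) (norm_nonneg _)
  · simpa using hσ.2.const_mul C

/-- `(a · σ)(χ, ψ) = χ(a) σ(χ, ψ)` -/
instance : Module A S.sections₀ where
  smul a σ := ⟨fun p => p.1.1 a • σ.1 p, smul_mem_sections₀ _ (continuous_onA a) ‖a‖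
    (fun p => NonUnitalStarAlgHom.norm_apply_le p.1.1 a) σ.2⟩
  one_smul σ := Subtype.ext <| funext fun p => by
    change p.1.1 1 • σ.1 p = _
    rw [map_one, one_smul]
  mul_smul a b σ := Subtype.ext <| funext fun p => by
    change p.1.1 (a * b) • σ.1 p = p.1.1 a • p.1.1 b • σ.1 p
    rw [map_mul, mul_smul]
  smul_zero a := Subtype.ext <| funext fun p => smul_zero (p.1.1 a)
  smul_add a σ τ := Subtype.ext <| funext fun p => smul_add (p.1.1 a) (σ.1 p) (τ.1 p)
  add_smul a b σ := Subtype.ext <| funext fun p => by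
    change p.1.1 (a + b) • σ.1 p = p.1.1 a • σ.1 p + p.1.1 b • σ.1 p
    rw [map_add, add_smul]
  zero_smul σ := Subtype.ext <| funext fun p => by
    change p.1.1 0 • σ.1 p = 0
    rw [map_zero, zero_smul]

/-- `(σ · b)(χ, ψ) = ψ(b) σ(χ, ψ)` -/
instance : Module Bᵐᵒᵖ S.sections₀ where
  smul b σ := ⟨fun p => p.1.2 b.unop • σ.1 p,
    smul_mem_sections₀ _ (continuous_onB b.unop) ‖b.unop‖
      (fun p => NonUnitalStarAlgHom.norm_apply_le p.1.2 b.unop) σ.2⟩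
  one_smul σ := Subtype.ext <| funext fun p => by
    change p.1.2 1 • σ.1 p = _
    rw [map_one, one_smul]
  mul_smul a b σ := Subtype.ext <| funext fun p => by
    change p.1.2 (b.unop * a.unop) • σ.1 p = p.1.2 a.unop • p.1.2 b.unop • σ.1 p
    rw [mul_comm, map_mul, mul_smul]
  smul_zero b := Subtype.ext <| funext fun p => smul_zero (p.1.2 b.unop)
  smul_add b σ τ := Subtype.ext <| funext fun p => smul_add (p.1.2 b.unop) (σ.1 p) (τ.1 p)
  add_smul a b σ := Subtype.ext <| funext fun p => by
    change p.1.2 (a.unop + b.unop) • σ.1 p = p.1.2 a.unop • σ.1 p + p.1.2 b.unop • σ.1 p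
    rw [map_add, add_smul]
  zero_smul σ := Subtype.ext <| funext fun p => by
    change p.1.2 0 • σ.1 p = 0
    rw [map_zero, zero_smul]

instance : IsScalarTower ℂ A S.sections₀ where
  smul_assoc c a σ := Subtype.ext <| funext fun p => by
    change p.1.1 (c • a) • σ.1 p = c • p.1.1 a • σ.1 p
    rw [map_smul, smul_assoc]

instance : IsScalarTower ℂ Bᵐᵒᵖ S.sections₀ where
  smul_assoc c b σ := Subtype.ext <| funext fun p => by
    change p.1.2 (c • b.unop) • σ.1 p = c • p.1.2 b.unop • σ.1 p
    rw [map_smul, smul_assoc]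

instance : SMulCommClass A Bᵐᵒᵖ S.sections₀ where
  smul_comm a b σ := Subtype.ext <| funext fun p =>
    smul_comm (p.1.1 a) (p.1.2 b.unop) (σ.1 p)

end ImprimitivityBimodule

end

noncomputable section

namespace ImprimitivityBimodule
variable {A B M N : Type*}
  [CommCStarAlgebra A] [PartialOrder A] [StarOrderedRing A]
  [CommCStarAlgebra B] [PartialOrder B] [StarOrderedRing B]
  [AddCommGroup M] [Module ℂ M] [Module A M] [Module Bᵐᵒᵖ M]
  [IsScalarTower ℂ A M] [IsScalarTower ℂ Bᵐᵒᵖ M] [SMulCommClass A Bᵐᵒᵖ M]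
variable {S : ImprimitivityBimodule A B M}

/-! The theorem rests on the exchange identity `⟨x,y⟩⟨z,u⟩ = ⟨x,u⟩⟨z,y⟩` in `A`
(`left_mul_left_swap`), which follows from imprimitivity and the commutativity of both algebras. It
says that a character `χ` turns the left inner product into a form of rank at most one. If `χ⟨z,z⟩ =
1`, then `ω = χ⟨·,z⟩` and `ψ(b) = ω(zb)` complete `χ` to a `*`-functor (`functorOfUnit`); if `χ⟨x,x⟩
= 0` for all `x`, then `χ` kills every inner product.

Hence the base projects onto the open set of those `χ` with some `χ⟨x,x⟩ ≠ 0`, and `ψ(b) = χ⟨xb,x⟩ /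
χ⟨x,x⟩` depends continuously on `χ`: the first projection is an open embedding. The second one is
treated by interchanging the two sides. Each fibre is a line, spanned by any transform that does not
vanish there, and such transforms give the trivializations.

The Gel'fand transform is isometric for the supremum norm, since characters off the base contribute
nothing to `‖⟨x,x⟩‖`. Its range is dense by a partition of unity whose functions come from elements
of `A`, hence everything by completeness of `M`. The bimodule structure on sections is then the one
transported from `M`. -/

/-! ### Commutative C*-algebras and the exchange identity -/

lemma eq_zero_of_forall_character {R : Type*} [CommCStarAlgebra R] {a : R}
    (h : ∀ χ : WeakDual.characterSpace ℂ R, χ a = 0) : a = 0 := by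
  apply (gelfandStarTransform R).injective
  rw [map_zero]
  ext χ
  exact h χ

lemma norm_le_of_forall_character {R : Type*} [CommCStarAlgebra R] {a : R} {C : ℝ} (hC : 0 ≤ C)
    (h : ∀ χ : WeakDual.characterSpace ℂ R, ‖χ a‖ ≤ C) : ‖a‖ ≤ C := by
  have e : ‖WeakDual.gelfandTransform ℂ R a‖ = ‖a‖ :=
    (gelfandTransform_isometry R).norm_map_of_map_zero (map_zero _) a
  rw [← e, ContinuousMap.norm_le _ hC]
  exact h

lemma eq_zero_of_mul_self {R : Type*} [CommCStarAlgebra R] {a : R} (h : a * a = 0) : a = 0 :=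
  eq_zero_of_forall_character fun χ => by
    have := congrArg χ h
    rwa [map_mul, map_zero, mul_self_eq_zero] at this

variable (S)

lemma right_smul_left (b : B) (x y : M) :
    S.right (MulOpposite.op b • x) y = star b * S.right x y := by
  rw [← S.right_star, S.right_smul, star_mul, S.right_star]

/-- Without fullness, `d • z = 0` for all `z` does not give `d = 0`. If `d` is itself a combination
of inner products, however, this lemma gives `d * d = 0`, which suffices by `eq_zero_of_mul_self`.
-/
lemma mul_left_eq_zero {d : A} {z : M} (h : d • z = 0) (w : M) : d * S.left z w = 0 := by
  have h0 : S.left (0 : M) w = 0 := by simpa using S.left_add 0 0 w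
  rw [← S.left_smul, h, h0]

/-- The right action of `B` is by adjointable operators for the left inner product. -/
lemma left_op_smul (b : B) (x y : M) :
    S.left (MulOpposite.op b • x) y = S.left x (MulOpposite.op (star b) • y) := by
  rw [← sub_eq_zero]
  set d := S.left (MulOpposite.op b • x) y - S.left x (MulOpposite.op (star b) • y) with hd
  have h : ∀ z : M, d • z = 0 := fun z => by
    rw [hd, sub_smul, S.imprimitivity, S.imprimitivity, S.right_smul_left, star_star, smul_smul,
      ← MulOpposite.op_mul, sub_self]
  apply eq_zero_of_mul_self
  nth_rw 2 [hd]
  rw [mul_sub, S.mul_left_eq_zero (h _), S.mul_left_eq_zero (h _), sub_zero]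

/-- Commutativity of `A` and `B` allows to exchange the second arguments in a product. -/
lemma left_mul_left_swap (x y z u : M) :
    S.left x y * S.left z u = S.left x u * S.left z y := by
  -- The right-hand side is symmetric in `y` and `u` because `B` is commutative.
  have key : ∀ y u : M, (S.left x y * S.left z u) • z
      = MulOpposite.op (S.right y z * S.right u z) • x := fun y u => by
    rw [MulOpposite.op_mul, ← smul_smul, ← smul_smul, S.imprimitivity z u z, smul_comm,
      S.imprimitivity x y z, smul_smul]
  have h : (S.left x y * S.left z u - S.left x u * S.left z y) • z = 0 := by
    rw [sub_smul, key, key, mul_comm (S.right u z), sub_self]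
  rw [← sub_eq_zero]
  apply eq_zero_of_mul_self
  set d := S.left x y * S.left z u - S.left x u * S.left z y with hd
  nth_rw 2 [hd]
  rw [mul_sub]
  -- Here `d` is only known to kill `z`, but both terms of `d` contain a factor `S.left z _`.
  rw [mul_left_comm, S.mul_left_eq_zero h, mul_left_comm, S.mul_left_eq_zero h]
  simp

/-! ### Extending a character of `A` to a `*`-functor -/

lemma character_left_star (χ : WeakDual.characterSpace ℂ A) (x y : M) :
    star (χ (S.left x y)) = χ (S.left y x) := by
  rw [← map_star, S.left_star]

/-- If `χ(⟨z, z⟩_A) = 1`, then `x ↦ χ(⟨x, z⟩_A)` is part of a `*`-functor over `χ`. -/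
def functorOfUnit (χ : WeakDual.characterSpace ℂ A) (z : M) (hz : χ (S.left z z) = 1) :
    S.LinkingFunctor :=
  let ω : M →ₗ[ℂ] ℂ :=
    { toFun x := χ (S.left x z)
      map_add' x y := by rw [S.left_add, map_add]
      map_smul' c x := by rw [left_complex_smul, map_smul]; rfl }
  -- The exchange identity gives `⟨x,z⟩⟨z,y⟩ = ⟨x,y⟩⟨z,z⟩`, and `χ⟨z,z⟩ = 1`.
  have mul (x y : M) : χ (S.left x y) = ω x * star (ω y) := by
    change _ = χ (S.left x z) * star (χ (S.left y z))
    rw [S.character_left_star, ← map_mul, ← S.left_mul_left_swap, map_mul, hz, mul_one]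
  -- Moving `b` to the second slot as `star b` leaves `x` free for the exchange with `z`. The case
  -- `x = z • c` makes `b ↦ ω(zb)` multiplicative.
  have hb (b : B) (x : M) :
      ω (MulOpposite.op b • x) = ω x * ω (MulOpposite.op b • z) := by
    change χ (S.left _ z) = χ (S.left x z) * χ (S.left _ z)
    rw [S.left_op_smul, S.left_op_smul, ← map_mul, ← S.left_mul_left_swap, map_mul, hz, mul_one]
  { onA := χ
    onB := WeakDual.CharacterSpace.equivAlgHom.symm
      { toFun b := ω (MulOpposite.op b • z)
        map_one' := by rw [MulOpposite.op_one, one_smul]; exact hz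
        map_mul' b c := by rw [mul_comm, MulOpposite.op_mul, ← smul_smul, hb, mul_comm,
          mul_comm (ω _)]
        map_zero' := by rw [MulOpposite.op_zero, zero_smul, map_zero]
        map_add' b c := by rw [MulOpposite.op_add, add_smul, map_add]
        commutes' c := by
          rw [Algebra.algebraMap_eq_smul_one, MulOpposite.op_smul, MulOpposite.op_one, smul_assoc,
            one_smul, map_smul]
          change c * χ (S.left z z) = c
          rw [hz, mul_one] }
    onM := ω
    map_left_smul a x := by
      change χ (S.left _ z) = χ a * χ (S.left x z)
      rw [S.left_smul, map_mul]
    map_right_smul := hb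
    map_left := mul
    map_right x y := by
      change ω (MulOpposite.op (S.right x y) • z) = _
      rw [← S.imprimitivity]
      change χ (S.left _ z) = star (χ (S.left x z)) * χ (S.left y z)
      rw [S.left_smul, map_mul, S.character_left_star] }

lemma exists_functor {χ : WeakDual.characterSpace ℂ A} {x : M} (hx : χ (S.left x x) ≠ 0) :
    ∃ ψ, (χ, ψ) ∈ S.graph := by
  have h0 : 0 ≤ χ (S.left x x) := by
    obtain ⟨a, ha⟩ := CStarAlgebra.nonneg_iff_eq_star_mul_self.mp (S.left_nonneg x)
    rw [ha, map_mul, map_star]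
    exact star_mul_self_nonneg _
  obtain ⟨r, hr, hrx⟩ : ∃ r : ℝ, 0 ≤ r ∧ (r : ℂ) = χ (S.left x x) :=
    ⟨_, (Complex.nonneg_iff.mp h0).1, Complex.ext rfl (Complex.nonneg_iff.mp h0).2⟩
  have hr0 : r ≠ 0 := by rintro rfl; simp at hrx; exact hx hrx.symm
  -- Rescaling by `χ⟨x,x⟩^(-1/2)` produces the unit vector that `functorOfUnit` needs.
  set c : ℂ := (((√r)⁻¹ : ℝ) : ℂ) with hc
  have hz : χ (S.left (c • x) (c • x)) = 1 := by
    rw [left_complex_smul, ← S.left_star, left_complex_smul, star_smul, S.left_star, map_smul,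
      map_smul, ← hrx, hc, smul_eq_mul, smul_eq_mul, Complex.star_def, Complex.conj_ofReal,
      ← Complex.ofReal_mul, ← Complex.ofReal_mul, ← mul_assoc, ← mul_inv,
      Real.mul_self_sqrt hr, inv_mul_cancel₀ hr0, Complex.ofReal_one]
  refine ⟨(S.functorOfUnit χ _ hz).onB, S.functorOfUnit χ _ hz, rfl, rfl, fun h => ?_⟩
  have : χ (S.left (c • x) (c • x)) = 0 := LinearMap.congr_fun h (c • x)
  rw [hz] at this
  exact one_ne_zero this

variable {S}

lemma character_right_smul (p : S.graph) (b : B) (x y : M) :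
    p.1.1 (S.left (MulOpposite.op b • x) y) = p.1.2 b * p.1.1 (S.left x y) := by
  obtain ⟨ω, hA, hB, -⟩ := p.2
  rw [← hA, ← hB, ω.map_left, ω.map_left, ω.map_right_smul]
  ring

lemma exists_character_ne_zero (p : S.graph) : ∃ x, p.1.1 (S.left x x) ≠ 0 := by
  obtain ⟨ω, hA, -, hω⟩ := p.2
  obtain ⟨x, hx⟩ := DFunLike.ne_iff.mp hω
  refine ⟨x, ?_⟩
  rw [← hA, ω.map_left]
  exact mul_ne_zero hx (star_ne_zero.mpr hx)

lemma character_right_eq (p : S.graph) (x y : M) :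
    p.1.2 (S.right x y) = p.1.1 (S.left y x) := by
  obtain ⟨ω, hA, hB, -⟩ := p.2
  rw [← hA, ← hB, ω.map_left, ω.map_right, mul_comm]

/-- This formula recovers `ψ` from `χ`. It yields both injectivity of the first projection and
continuity of its inverse, as one `x` serves for all nearby points. -/
lemma character_eq_div (p : S.graph) {x : M} (hx : p.1.1 (S.left x x) ≠ 0) (b : B) :
    p.1.2 b = p.1.1 (S.left (MulOpposite.op b • x) x) / p.1.1 (S.left x x) := by
  rw [character_right_smul, mul_div_cancel_right₀ _ hx]

variable (S)

/-! ### The base space and its two projections -/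

lemma isOpenEmbedding_fst : IsOpenEmbedding fun p : S.graph => p.1.1 where
  eq_induced := by
    refine (isInducing_iff_nhds.mpr fun p => le_antisymm ?_ ?_).eq_induced
    · exact (continuous_fst.comp continuous_subtype_val).continuousAt.le_comap
    · obtain ⟨x, hx⟩ := exists_character_ne_zero p
      have h1 : Tendsto (fun q : S.graph => q.1.1) (comap (fun q : S.graph => q.1.1) (𝓝 p.1.1))
        (𝓝 p.1.1) := tendsto_comap
      have ev (a : A) : Tendsto (fun q : S.graph => q.1.1 a)
          (comap (fun q : S.graph => q.1.1) (𝓝 p.1.1)) (𝓝 (p.1.1 a)) :=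
        (((WeakDual.eval_continuous a).comp continuous_subtype_val).tendsto p.1.1).comp h1
      change comap (fun q : S.graph => q.1.1) (𝓝 p.1.1) ≤ 𝓝 p
      rw [← tendsto_id']
      refine tendsto_subtype_rng.mpr (Prod.tendsto_iff _ _ |>.mpr ⟨h1, ?_⟩)
      refine tendsto_subtype_rng.mpr ?_
      -- Weak-* convergence of `ψ` is tested on each `b`, where `character_eq_div` applies with the
      -- fixed `x` as soon as the denominator is nonzero.
      refine (WeakBilin.tendsto_iff_forall_eval_tendsto _
        (ContinuousLinearMap.coe_injective)).mpr fun b => ?_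
      change Tendsto (fun q : S.graph => q.1.2 b) _ (𝓝 (p.1.2 b))
      rw [character_eq_div p hx]
      refine ((ev _).div (ev _) hx).congr' ?_
      filter_upwards [(ev (S.left x x)).eventually_ne hx] with q hq
      exact (character_eq_div q hq b).symm
  injective p q h := by
    obtain ⟨x, hx⟩ := exists_character_ne_zero p
    replace h : p.1.1 = q.1.1 := h
    refine Subtype.ext (Prod.ext h ?_)
    ext b
    rw [character_eq_div p hx, character_eq_div q (h ▸ hx), h]
  isOpen_range := by
    have : Set.range (fun p : S.graph => p.1.1) = ⋃ x : M, {χ | χ (S.left x x) ≠ 0} := by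
      ext χ
      rw [Set.mem_iUnion]
      constructor
      · rintro ⟨p, rfl⟩
        exact exists_character_ne_zero p
      · rintro ⟨x, hx⟩
        obtain ⟨ψ, hψ⟩ := S.exists_functor hx
        exact ⟨⟨_, hψ⟩, rfl⟩
    rw [this]
    exact isOpen_iUnion fun x => isOpen_ne_fun
      ((WeakDual.eval_continuous _).comp continuous_subtype_val) continuous_const

/-- The diagonal values vanish by `exists_functor`, and the exchange identity gives `|χ⟨x,y⟩|² =
χ⟨x,x⟩ χ⟨y,y⟩`. -/
lemma character_left_eq_zero {χ : WeakDual.characterSpace ℂ A}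
    (h : ∀ p : S.graph, p.1.1 ≠ χ) (x y : M) : χ (S.left x y) = 0 := by
  have h0 (x : M) : χ (S.left x x) = 0 := by
    by_contra hx
    obtain ⟨ψ, hψ⟩ := S.exists_functor hx
    exact h ⟨_, hψ⟩ rfl
  have := congrArg χ (S.left_mul_left_swap x y y x)
  rw [map_mul, map_mul, h0, zero_mul, ← S.character_left_star χ x y] at this
  simpa using this

/-! ### Interchanging the two sides -/

/-- `M` with the left and the right action interchanged, as a `B`-`A`-bimodule. -/
def Flip (_ : ImprimitivityBimodule A B M) : Type _ := M

instance : AddCommGroup S.Flip := inferInstanceAs (AddCommGroup M)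

instance : Module ℂ S.Flip := inferInstanceAs (Module ℂ M)

instance : Module B S.Flip := Module.compHom M (RingEquiv.toOpposite B).toRingHom

instance : Module Aᵐᵒᵖ S.Flip := Module.compHom M (RingEquiv.toOpposite A).symm.toRingHom

instance : IsScalarTower ℂ B S.Flip where
  smul_assoc c b x := smul_assoc c (MulOpposite.op b) (show M from x)

instance : IsScalarTower ℂ Aᵐᵒᵖ S.Flip where
  smul_assoc c a x := smul_assoc c a.unop (show M from x)

instance : SMulCommClass B Aᵐᵒᵖ S.Flip where
  smul_comm b a x := (smul_comm a.unop (MulOpposite.op b) (show M from x)).symm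

/-- The imprimitivity bimodule with both sides interchanged. -/
def flip : ImprimitivityBimodule B A S.Flip where
  left x y := S.right y x
  left_add x y z := S.right_add z x y
  left_smul b x y := (S.right_smul b y x).trans (mul_comm _ _)
  left_star x y := S.right_star y x
  left_nonneg := S.right_nonneg
  left_definite := S.right_definite
  right x y := S.left y x
  right_add x y z := S.left_add y z x
  right_smul a x y := (S.left_smul a y x).trans (mul_comm _ _)
  right_star x y := S.left_star y x
  right_nonneg := S.left_nonneg
  right_definite := S.left_definite
  imprimitivity x y z := (S.imprimitivity z y x).symm
  left_complete := S.right_complete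
  right_complete := S.left_complete

/-- A `*`-functor on the linking category, seen on that of the flipped bimodule. -/
def LinkingFunctor.flip (ω : S.LinkingFunctor) : S.flip.LinkingFunctor where
  onA := ω.onB
  onB := ω.onA
  onM := ω.onM
  map_left_smul b x := (ω.map_right_smul b x).trans (mul_comm _ _)
  map_right_smul a x := (ω.map_left_smul a x).trans (mul_comm _ _)
  map_left x y := (ω.map_right y x).trans (mul_comm _ _)
  map_right x y := (ω.map_left y x).trans (mul_comm _ _)

/-- A `*`-functor on the linking category of the flipped bimodule, seen on the original one. -/
def LinkingFunctor.unflip (ω : S.flip.LinkingFunctor) : S.LinkingFunctor where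
  onA := ω.onB
  onB := ω.onA
  onM := ω.onM
  map_left_smul a x := (ω.map_right_smul a x).trans (mul_comm _ _)
  map_right_smul b x := (ω.map_left_smul b x).trans (mul_comm _ _)
  map_left x y := (ω.map_right y x).trans (mul_comm _ _)
  map_right x y := (ω.map_left y x).trans (mul_comm _ _)

lemma swap_mem_graph_flip (p : S.graph) : p.1.swap ∈ S.flip.graph := by
  obtain ⟨ω, hA, hB, hω⟩ := p.2
  exact ⟨LinkingFunctor.flip S ω, hB, hA, hω⟩

lemma swap_mem_graph (p : S.flip.graph) : p.1.swap ∈ S.graph := by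
  obtain ⟨ω, hA, hB, hω⟩ := p.2
  exact ⟨LinkingFunctor.unflip S ω, hB, hA, hω⟩

/-- The base space of the flipped bimodule is the transposed graph. -/
def graphFlip : S.graph ≃ₜ S.flip.graph where
  toFun p := ⟨p.1.swap, S.swap_mem_graph_flip p⟩
  invFun p := ⟨p.1.swap, S.swap_mem_graph p⟩
  left_inv _ := rfl
  right_inv _ := rfl
  continuous_toFun := (continuous_swap.comp continuous_subtype_val).subtype_mk _
  continuous_invFun := (continuous_swap.comp continuous_subtype_val).subtype_mk _

lemma isOpenEmbedding_snd : IsOpenEmbedding fun p : S.graph => p.1.2 :=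
  S.flip.isOpenEmbedding_fst.comp S.graphFlip.isOpenEmbedding

lemma character_right_eq_zero {ψ : WeakDual.characterSpace ℂ B}
    (h : ∀ p : S.graph, p.1.2 ≠ ψ) (x y : M) : ψ (S.right x y) = 0 :=
  S.flip.character_left_eq_zero (fun p => h (S.graphFlip.symm p)) y x

/-- The base space is the graph of a homeomorphism between open sets of characters. -/
lemma exists_homeomorph_graph :
    ∃ (U : Set (WeakDual.characterSpace ℂ A)) (V : Set (WeakDual.characterSpace ℂ B))
      (h : U ≃ₜ V), IsOpen U ∧ IsOpen V ∧ S.graph = Set.range fun u : U => (u.1, (h u).1) := by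
  set e₁ := S.isOpenEmbedding_fst.isEmbedding.toHomeomorph
  set e₂ := S.isOpenEmbedding_snd.isEmbedding.toHomeomorph
  refine ⟨_, _, e₁.symm.trans e₂, S.isOpenEmbedding_fst.isOpen_range,
    S.isOpenEmbedding_snd.isOpen_range, ?_⟩
  have key (p : S.graph) : ((e₁ p).1, (e₂ p).1) = p.1 := rfl
  ext q
  constructor
  · intro hq
    refine ⟨e₁ ⟨q, hq⟩, ?_⟩
    change (_, (e₂ (e₁.symm (e₁ _))).1) = _
    rw [e₁.symm_apply_apply]
    exact key _
  · rintro ⟨u, rfl⟩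
    obtain ⟨p, rfl⟩ := e₁.surjective u
    change (_, (e₂ (e₁.symm (e₁ _))).1) ∈ _
    rw [e₁.symm_apply_apply, key]
    exact p.2

lemma locallyCompactSpace_graph : LocallyCompactSpace S.graph :=
  S.isOpenEmbedding_fst.locallyCompactSpace

variable {S}

/-! ### Fibres and the tubular topology -/

/-- Reduces equations in a fibre to equations between values of `ω`. -/
lemma gelfand_eq_of_functor {p : S.graph} {ω : S.LinkingFunctor} (hω : ω.onA = p.1.1)
    {x y : M} (h : ω.onM x = ω.onM y) : S.gelfand x p = S.gelfand y p := by
  rw [← sub_eq_zero, ← gelfand_sub, ← inner_self_eq_zero (𝕜 := ℂ), inner_gelfand, ← hω,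
    ω.map_left, map_sub, h, sub_self, zero_mul]

lemma gelfand_smul_left (a : A) (x : M) (p : S.graph) :
    S.gelfand (a • x) p = p.1.1 a • S.gelfand x p := by
  obtain ⟨ω, hA, hB, -⟩ := p.2
  rw [← gelfand_smul]
  apply gelfand_eq_of_functor hA
  rw [ω.map_left_smul, map_smul, hA, smul_eq_mul]

lemma gelfand_smul_right (b : B) (x : M) (p : S.graph) :
    S.gelfand (MulOpposite.op b • x) p = p.1.2 b • S.gelfand x p := by
  obtain ⟨ω, hA, hB, -⟩ := p.2
  rw [← gelfand_smul]
  apply gelfand_eq_of_functor hA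
  rw [ω.map_right_smul, map_smul, hB, smul_eq_mul, mul_comm]

/-- The fibres are one-dimensional. -/
lemma inner_div_smul_gelfand {p : S.graph} {x : M} (hx : p.1.1 (S.left x x) ≠ 0)
    (e : S.Fiber p) :
    (⟪S.gelfand x p, e⟫_ℂ / p.1.1 (S.left x x)) • S.gelfand x p = e := by
  obtain ⟨y, rfl⟩ := gelfand_surjective p e
  obtain ⟨ω, hA, hB, -⟩ := p.2
  rw [inner_gelfand, ← gelfand_smul]
  apply gelfand_eq_of_functor hA
  rw [← hA, ω.map_left] at hx
  rw [← hA, ω.map_left, ω.map_left, map_smul, smul_eq_mul]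
  have h1 : ω.onM x ≠ 0 := left_ne_zero_of_mul hx
  have h2 : star (ω.onM x) ≠ 0 := right_ne_zero_of_mul hx
  field_simp

lemma isOpen_tube (x : M) {ε : ℝ} (hε : 0 < ε) {O : Set S.graph} (hO : IsOpen O) :
    IsOpen (S.tube x ε O) :=
  TopologicalSpace.isOpen_generateFrom_of_mem ⟨x, ε, O, hε, hO, rfl⟩

lemma continuous_totalSpace_proj : Continuous (π ℂ S.Fiber) := by
  refine continuous_def.mpr fun O hO => isOpen_iff_mem_nhds.mpr fun e he => ?_
  -- A tube around the zero section, wide enough to contain `e`, sees only the base point.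
  have h : e ∈ S.tube 0 (‖e.snd - S.gelfand 0 e.proj‖ + 1) O := ⟨he, lt_add_one _⟩
  filter_upwards [(isOpen_tube 0 (by positivity) hO).mem_nhds h] with f hf using hf.1

/-- Near `e`, points of the total space may be replaced by values of a transform through `e`, whose
norms and inner products are evaluations of elements of `A`. Continuity on the total space is proved
this way. -/
lemma tendsto_norm_sub_gelfand {e : TotalSpace ℂ S.Fiber} {z : M}
    (hz : S.gelfand z e.proj = e.snd) :
    Tendsto (fun f : TotalSpace ℂ S.Fiber => ‖f.snd - S.gelfand z f.proj‖) (𝓝 e) (𝓝 0) := by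
  rw [Metric.tendsto_nhds]
  intro ε hε
  have h : e ∈ S.tube z ε Set.univ := ⟨Set.mem_univ _, by rwa [hz, sub_self, norm_zero]⟩
  filter_upwards [(isOpen_tube z hε isOpen_univ).mem_nhds h] with f hf
  rw [Real.dist_0_eq_abs, abs_of_nonneg (norm_nonneg _)]
  exact hf.2

lemma continuous_norm_snd : Continuous fun e : TotalSpace ℂ S.Fiber => ‖e.snd‖ := by
  refine continuous_iff_continuousAt.mpr fun e => ?_
  obtain ⟨z, hz⟩ := gelfand_surjective e.proj e.snd
  have h1 := tendsto_norm_sub_gelfand hz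
  have h2 : Tendsto (fun f : TotalSpace ℂ S.Fiber => ‖S.gelfand z f.proj‖) (𝓝 e) (𝓝 ‖e.snd‖) := by
    rw [← hz]
    exact ((continuous_norm_gelfand z).comp continuous_totalSpace_proj).tendsto e
  refine tendsto_of_tendsto_of_tendsto_of_le_of_le (by simpa using h2.sub h1)
    (by simpa using h2.add h1) (fun f => ?_) (fun f => ?_)
  · have := norm_sub_norm_le (S.gelfand z f.proj) f.snd
    rw [norm_sub_rev] at this
    change ‖_‖ - ‖_‖ ≤ ‖_‖
    linarith
  · have := norm_sub_norm_le f.snd (S.gelfand z f.proj)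
    change ‖_‖ ≤ ‖_‖ + ‖_‖
    linarith

lemma continuous_inner_gelfand_snd (x : M) :
    Continuous fun e : TotalSpace ℂ S.Fiber => ⟪S.gelfand x e.proj, e.snd⟫_ℂ := by
  refine continuous_iff_continuousAt.mpr fun e => ?_
  obtain ⟨z, hz⟩ := gelfand_surjective e.proj e.snd
  have h1 := tendsto_norm_sub_gelfand hz
  have h2 : Tendsto (fun f : TotalSpace ℂ S.Fiber => ‖S.gelfand x f.proj‖) (𝓝 e)
      (𝓝 ‖S.gelfand x e.proj‖) :=
    ((continuous_norm_gelfand x).comp continuous_totalSpace_proj).tendsto e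
  have h3 : Tendsto (fun f : TotalSpace ℂ S.Fiber => ⟪S.gelfand x f.proj, S.gelfand z f.proj⟫_ℂ)
      (𝓝 e) (𝓝 ⟪S.gelfand x e.proj, e.snd⟫_ℂ) := by
    rw [← hz]
    exact ((continuous_onA (S.left z x)).comp continuous_totalSpace_proj).tendsto e
  have h4 : Tendsto (fun f : TotalSpace ℂ S.Fiber =>
      ⟪S.gelfand x f.proj, f.snd - S.gelfand z f.proj⟫_ℂ) (𝓝 e) (𝓝 0) :=
    squeeze_zero_norm (fun f => norm_inner_le_norm _ _) (by simpa using h2.mul h1)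
  simpa [ContinuousAt, inner_sub_right] using h3.add h4

/-- The squared distance `‖c x̂ - ŷ‖²` is a polynomial in `c`, its conjugate and evaluations of `χ`,
so preimages of tubes are open. -/
lemma continuous_smul_gelfand (x : M) :
    Continuous fun q : S.graph × ℂ => TotalSpace.mk' ℂ q.1 (q.2 • S.gelfand x q.1) := by
  rw [continuous_generateFrom_iff]
  rintro _ ⟨y, ε, O, -, hO, rfl⟩
  have h : Continuous fun q : S.graph × ℂ => ‖q.2 • S.gelfand x q.1 - S.gelfand y q.1‖ := by
    have e (q : S.graph × ℂ) : ‖q.2 • S.gelfand x q.1 - S.gelfand y q.1‖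
        = √(RCLike.re (star q.2 * q.2 * q.1.1.1 (S.left x x)
          - star q.2 * q.1.1.1 (S.left y x) - q.2 * q.1.1.1 (S.left x y)
          + q.1.1.1 (S.left y y))) := by
      rw [norm_eq_sqrt_re_inner (𝕜 := ℂ)]
      congr 2
      simp only [inner_sub_left, inner_sub_right, inner_smul_left, inner_smul_right,
        inner_gelfand, starRingEnd_apply]
      ring
    simp only [e]
    have c (a : A) : Continuous fun q : S.graph × ℂ => q.1.1.1 a :=
      (continuous_onA a).comp continuous_fst
    refine Real.continuous_sqrt.comp (RCLike.continuous_re.comp ?_)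
    have s : Continuous fun q : S.graph × ℂ => star q.2 := continuous_snd.star
    exact ((((s.mul continuous_snd).mul (c _)).sub (s.mul (c _))).sub
      (continuous_snd.mul (c _))).add (c _)
  exact (hO.preimage continuous_fst).inter (isOpen_lt h continuous_const)

lemma isInducing_totalSpaceMk (p : S.graph) :
    IsInducing (TotalSpace.mk p : S.Fiber p → TotalSpace ℂ S.Fiber) := by
  refine isInducing_iff_nhds.mpr fun e => le_antisymm (Tendsto.le_comap ?_) ?_
  · obtain ⟨x, hx⟩ := exists_character_ne_zero p
    have h : Continuous fun f : S.Fiber p =>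
        TotalSpace.mk' ℂ p ((⟪S.gelfand x p, f⟫_ℂ / p.1.1 (S.left x x)) • S.gelfand x p) :=
      (continuous_smul_gelfand x).comp (continuous_const.prodMk
        ((continuous_const.inner continuous_id).div_const _))
    simp only [inner_div_smul_gelfand hx] at h
    exact h.tendsto e
  · obtain ⟨z, hz⟩ := gelfand_surjective p e
    rw [← tendsto_id', tendsto_iff_norm_sub_tendsto_zero]
    have h := (tendsto_norm_sub_gelfand (e := TotalSpace.mk p e) hz).comp
      (tendsto_comap (f := (TotalSpace.mk p : S.Fiber p → TotalSpace ℂ S.Fiber)))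
    rw [← hz] at *
    exact h

/-! ### Local trivializations and the line bundle -/

variable (S) in
/-- The trivialization given by the Gel'fand transform of `x`, where that does not vanish. -/
def gelfandTrivialization (x : M) : Trivialization ℂ (π ℂ S.Fiber) where
  toFun e := (e.proj, ⟪S.gelfand x e.proj, e.snd⟫_ℂ / e.proj.1.1 (S.left x x))
  invFun q := TotalSpace.mk' ℂ q.1 (q.2 • S.gelfand x q.1)
  source := π ℂ S.Fiber ⁻¹' {p : S.graph | p.1.1 (S.left x x) ≠ 0}
  target := {p : S.graph | p.1.1 (S.left x x) ≠ 0} ×ˢ Set.univ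
  baseSet := {p : S.graph | p.1.1 (S.left x x) ≠ 0}
  map_source' _ he := ⟨he, Set.mem_univ _⟩
  map_target' _ hq := hq.1
  left_inv' e he := by
    obtain ⟨p, e⟩ := e
    change TotalSpace.mk' ℂ p _ = _
    rw [inner_div_smul_gelfand he]
  right_inv' q hq := by
    refine Prod.ext rfl ?_
    change ⟪S.gelfand x q.1, q.2 • S.gelfand x q.1⟫_ℂ / q.1.1.1 (S.left x x) = q.2
    rw [inner_smul_right, inner_gelfand, mul_div_cancel_right₀ _ hq.1]
  open_source := (isOpen_ne_fun (continuous_onA _) continuous_const).preimage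
    continuous_totalSpace_proj
  open_target := (isOpen_ne_fun (continuous_onA _) continuous_const).prod isOpen_univ
  open_baseSet := isOpen_ne_fun (continuous_onA _) continuous_const
  continuousOn_toFun := continuous_totalSpace_proj.continuousOn.prodMk
    ((continuous_inner_gelfand_snd x).continuousOn.div
      ((continuous_onA _).comp continuous_totalSpace_proj).continuousOn fun _ he => he)
  continuousOn_invFun := (continuous_smul_gelfand x).continuousOn
  source_eq := rfl
  target_eq := rfl
  proj_toFun _ _ := rfl

variable (S) in
/-- The atlas of the trivializations given by Gel'fand transforms. -/
@[reducible] def fiberBundle : FiberBundle ℂ S.Fiber where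
  totalSpaceMk_isInducing' := isInducing_totalSpaceMk
  trivializationAtlas' := Set.range S.gelfandTrivialization
  trivializationAt' p := S.gelfandTrivialization (exists_character_ne_zero p).choose
  mem_baseSet_trivializationAt' p := (exists_character_ne_zero p).choose_spec
  trivialization_mem_atlas' _ := ⟨_, rfl⟩

instance (x : M) : (S.gelfandTrivialization x).IsLinear ℂ where
  linear p hp :=
    { map_add e f := by
        change ⟪S.gelfand x p, e + f⟫_ℂ / _ = ⟪S.gelfand x p, e⟫_ℂ / _ + ⟪S.gelfand x p, f⟫_ℂ / _
        rw [inner_add_right, add_div]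
      map_smul c e := by
        change ⟪S.gelfand x p, c • e⟫_ℂ / _ = c * (⟪S.gelfand x p, e⟫_ℂ / _)
        rw [inner_smul_right, mul_div_assoc] }

/-- The coordinate change is multiplication by `χ⟨x,y⟩ / χ⟨y,y⟩`. -/
lemma continuousOn_coordChange_gelfand (x y : M) :
    ContinuousOn (fun p => ((S.gelfandTrivialization x).coordChangeL ℂ
      (S.gelfandTrivialization y) p : ℂ →L[ℂ] ℂ))
      ((S.gelfandTrivialization x).baseSet ∩ (S.gelfandTrivialization y).baseSet) := by
  rw [continuousOn_clm_apply]
  intro c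
  have h : ContinuousOn (fun p : S.graph => c * p.1.1 (S.left x y) / p.1.1 (S.left y y))
      ((S.gelfandTrivialization x).baseSet ∩ (S.gelfandTrivialization y).baseSet) :=
    (continuous_const.mul (continuous_onA _)).continuousOn.div (continuous_onA _).continuousOn
      fun p hp => hp.2
  refine h.congr fun p hp => ?_
  rw [ContinuousLinearEquiv.coe_coe, Trivialization.coordChangeL_apply' _ _ hp]
  change ⟪S.gelfand y p, c • S.gelfand x p⟫_ℂ / _ = _
  rw [inner_smul_right, inner_gelfand]
  rfl

variable (S) in
lemma vectorBundle : letI := S.fiberBundle; VectorBundle ℂ ℂ S.Fiber := by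
  let := S.fiberBundle
  refine ⟨?_, ?_⟩
  · rintro _ ⟨x, rfl⟩
    infer_instance
  · rintro _ _ ⟨x, rfl⟩ ⟨y, rfl⟩
    exact continuousOn_coordChange_gelfand x y

/-! ### The Gel'fand transform is isometric and vanishes at infinity -/

lemma norm_gelfand_sq (x : M) (p : S.graph) :
    ((‖S.gelfand x p‖ ^ 2 : ℝ) : ℂ) = p.1.1 (S.left x x) := by
  rw [← inner_gelfand, inner_self_eq_norm_sq_to_K]
  push_cast
  rfl

lemma norm_character_left_self (x : M) (p : S.graph) :
    ‖p.1.1 (S.left x x)‖ = ‖S.gelfand x p‖ ^ 2 := by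
  rw [← norm_gelfand_sq, Complex.norm_real, Real.norm_of_nonneg (by positivity)]

lemma norm_gelfand_le (x : M) (p : S.graph) : ‖S.gelfand x p‖ ≤ √‖S.left x x‖ := by
  apply Real.le_sqrt_of_sq_le
  rw [← norm_character_left_self]
  exact NonUnitalStarAlgHom.norm_apply_le p.1.1 _

/-- The norm of `⟨x,x⟩` is the supremum over all characters of `A`, and those off the base
contribute `0`. With `norm_gelfand_le` this makes the transform isometric. -/
lemma sqrt_norm_left_le {x : M} {C : ℝ} (hC : 0 ≤ C) (h : ∀ p, ‖S.gelfand x p‖ ≤ C) :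
    √‖S.left x x‖ ≤ C := by
  refine Real.sqrt_le_iff.mpr ⟨hC, norm_le_of_forall_character (by positivity) fun χ => ?_⟩
  by_cases hχ : ∃ p : S.graph, p.1.1 = χ
  · obtain ⟨p, rfl⟩ := hχ
    rw [norm_character_left_self]
    exact pow_le_pow_left₀ (norm_nonneg _) (h p) 2
  · rw [S.character_left_eq_zero (not_exists.mp hχ), norm_zero]
    positivity

lemma gelfand_mem_sections₀ (x : M) : S.gelfand x ∈ S.sections₀ := by
  refine ⟨?_, ?_⟩
  · rw [continuous_section_iff]
    exact fun y ε => isOpen_lt (continuous_norm_gelfand (x - y)) continuous_const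
  · rw [Metric.tendsto_nhds]
    intro ε hε
    rw [Filter.eventually_iff, mem_cocompact]
    -- `K` is closed in the compact spectrum of the unital algebra `A` and lies in the image of the
    -- base, so it pulls back to a compact set.
    set K : Set (WeakDual.characterSpace ℂ A) := {χ | ε ^ 2 ≤ ‖χ (S.left x x)‖} with hK
    have hKc : IsCompact K := IsClosed.isCompact <| isClosed_le continuous_const
      (((WeakDual.eval_continuous _).comp continuous_subtype_val).norm)
    have hKr : K ⊆ Set.range fun p : S.graph => p.1.1 := fun χ hχ => by
      by_contra h
      have h0 := S.character_left_eq_zero (fun p hp => h ⟨p, hp⟩) x x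
      rw [hK, Set.mem_ofPred_eq, h0, norm_zero] at hχ
      exact absurd hχ (not_le.mpr (by positivity))
    refine ⟨_, S.isOpenEmbedding_fst.isInducing.isCompact_preimage' hKc hKr, fun p hp => ?_⟩
    replace hp : ¬ ε ^ 2 ≤ ‖p.1.1 (S.left x x)‖ := hp
    rw [norm_character_left_self, not_le] at hp
    change dist _ _ < ε
    rw [Real.dist_0_eq_abs, abs_of_nonneg (norm_nonneg _)]
    exact lt_of_pow_lt_pow_left₀ 2 hε.le hp

variable (S) in
/-- The Gel'fand transform as a linear map. -/
def gelfandMap : M →ₗ[ℂ] S.sections₀ where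
  toFun x := ⟨S.gelfand x, gelfand_mem_sections₀ x⟩
  map_add' _ _ := rfl
  map_smul' _ _ := rfl

lemma gelfand_injective : Function.Injective S.gelfandMap := by
  refine (injective_iff_map_eq_zero _).mpr fun x hx => S.left_definite x ?_
  have h : √‖S.left x x‖ ≤ 0 := sqrt_norm_left_le le_rfl fun p => by
    have : S.gelfand x p = 0 := congrFun (congrArg Subtype.val hx) p
    rw [this, norm_zero]
  exact norm_eq_zero.mp ((Real.sqrt_eq_zero (norm_nonneg _)).mp (le_antisymm h (Real.sqrt_nonneg _)))

/-! ### Surjectivity onto the sections vanishing at infinity -/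

/-- A partition of unity on the base space, subordinate to a cover of a compact set. -/
lemma exists_partition {ι : Type*} [Fintype ι] {K : Set S.graph} (hK : IsCompact K)
    (O : ι → Set S.graph) (hO : ∀ i, IsOpen (O i)) (hKO : K ⊆ ⋃ i, O i) :
    ∃ (a : ι → A) (f : ι → S.graph → ℝ), (∀ i p, p.1.1 (a i) = f i p) ∧ (∀ i p, 0 ≤ f i p) ∧
      (∀ i p, p ∉ O i → f i p = 0) ∧ (∀ p ∈ K, ∑ i, f i p = 1) ∧ ∀ p, ∑ i, f i p ≤ 1 := by
  set j : S.graph → WeakDual.characterSpace ℂ A := fun p => p.1.1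
  have hj : IsOpenEmbedding j := S.isOpenEmbedding_fst
  -- The partition is taken on the compact Hausdorff spectrum of `A`, where the image of `K` is
  -- closed and those of the `O i` are open; Gel'fand duality then turns its functions into elements
  -- of `A`.
  obtain ⟨F, hF⟩ := PartitionOfUnity.exists_isSubordinate
    (hK.image hj.continuous).isClosed (fun i => j '' O i) (fun i => hj.isOpenMap _ (hO i))
    (by rw [← Set.image_iUnion]; exact Set.image_mono hKO)
  refine ⟨fun i => (gelfandStarTransform A).symm
    ⟨fun χ => (F i χ : ℂ), Complex.continuous_ofReal.comp (F i).continuous⟩,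
    fun i p => F i (j p), fun i p => ?_, fun i p => F.nonneg i _, fun i p hp => ?_,
    fun p hp => ?_, fun p => ?_⟩
  · exact DFunLike.congr_fun ((gelfandStarTransform A).apply_symm_apply
      ⟨fun χ => (F i χ : ℂ), Complex.continuous_ofReal.comp (F i).continuous⟩) (j p)
  · by_contra h
    obtain ⟨q, hq, hqp⟩ := hF i (subset_tsupport _ (Function.mem_support.mpr h))
    exact hp (hj.injective hqp ▸ hq)
  · rw [← finsum_eq_sum_of_fintype]
    exact F.sum_eq_one (Set.mem_image_of_mem _ hp)
  · rw [← finsum_eq_sum_of_fintype]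
    exact F.sum_le_one _

lemma gelfand_sum {ι : Type*} (s : Finset ι) (x : ι → M) (p : S.graph) :
    S.gelfand (∑ i ∈ s, x i) p = ∑ i ∈ s, S.gelfand (x i) p :=
  map_sum ({ toFun := fun x => S.gelfand x p, map_zero' := rfl, map_add' := fun _ _ => rfl } :
    M →+ S.Fiber p) x s

lemma exists_gelfand_near {σ : ∀ p, S.Fiber p} (hσ : σ ∈ S.sections₀) {ε : ℝ} (hε : 0 < ε) :
    ∃ x, ∀ p, ‖S.gelfand x p - σ p‖ ≤ ε := by
  have hδ : 0 < ε / 2 := by positivity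
  obtain ⟨K, hK, hKσ⟩ := mem_cocompact.mp
    (hσ.2.eventually (eventually_lt_nhds hδ))
  choose y hy using fun p => gelfand_surjective p (σ p)
  set O : S.graph → Set S.graph := fun q => {p | ‖σ p - S.gelfand (y q) p‖ < ε / 2}
  have hOo (q) : IsOpen (O q) := (continuous_section_iff σ).mp hσ.1 _ _
  obtain ⟨t, ht⟩ := hK.elim_finite_subcover O hOo fun p _ => Set.mem_iUnion.mpr
    ⟨p, by change ‖σ p - S.gelfand (y p) p‖ < _; rwa [hy, sub_self, norm_zero]⟩
  obtain ⟨a, f, haf, hf0, hfO, hf1, hf⟩ := exists_partition hK (fun q : t => O q)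
    (fun q => hOo q) (by rwa [Set.iUnion_subtype])
  refine ⟨∑ q, a q • y q, fun p => ?_⟩
  -- The first sum is small by subordination. The second term vanishes on `K`, where the partition
  -- sums to `1`, and is small off `K`, where `σ` is.
  have key : S.gelfand (∑ q, a q • y q) p - σ p = (∑ q, (f q p : ℂ) • (S.gelfand (y q) p - σ p))
      - ((1 - ∑ q, f q p : ℝ) : ℂ) • σ p := by
    simp only [gelfand_sum, gelfand_smul_left, haf, smul_sub, Finset.sum_sub_distrib,
      ← Finset.sum_smul]
    push_cast
    rw [sub_smul, one_smul]
    abel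
  have h1 : ‖∑ q, (f q p : ℂ) • (S.gelfand (y q) p - σ p)‖ ≤ ε / 2 :=
    calc _ ≤ ∑ q, f q p * (ε / 2) := norm_sum_le_of_le _ fun q _ => by
          rw [norm_smul, Complex.norm_real, Real.norm_of_nonneg (hf0 q p)]
          by_cases hp : p ∈ O q
          · rw [norm_sub_rev]
            exact mul_le_mul_of_nonneg_left (le_of_lt hp) (hf0 q p)
          · rw [hfO q p hp, zero_mul, zero_mul]
      _ ≤ 1 * (ε / 2) := by
          rw [← Finset.sum_mul]
          exact mul_le_mul_of_nonneg_right (hf p) hδ.le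
      _ = _ := one_mul _
  have h2 : ‖((1 - ∑ q, f q p : ℝ) : ℂ) • σ p‖ ≤ ε / 2 := by
    by_cases hp : p ∈ K
    · rw [hf1 p hp, sub_self, Complex.ofReal_zero, zero_smul, norm_zero]
      exact hδ.le
    · rw [norm_smul, Complex.norm_real, Real.norm_of_nonneg (sub_nonneg.mpr (hf p))]
      have h3 : ‖σ p‖ < ε / 2 := hKσ hp
      have h4 : 0 ≤ ∑ q, f q p := Finset.sum_nonneg fun q _ => hf0 q p
      calc _ ≤ 1 * ‖σ p‖ := mul_le_mul_of_nonneg_right (by linarith) (norm_nonneg _)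
        _ ≤ _ := by rw [one_mul]; exact h3.le
  rw [key]
  calc _ ≤ _ := norm_sub_le _ _
    _ ≤ ε := by linarith

/-- Uniform approximants of `σ` are Cauchy in `M` by `sqrt_norm_left_le`, and the transform of their
limit agrees with `σ` at each point. -/
lemma gelfand_surjective_sections₀ : Function.Surjective S.gelfandMap := by
  rintro ⟨σ, hσ⟩
  choose u hu using fun n : ℕ => exists_gelfand_near hσ (Nat.one_div_pos_of_nat (α := ℝ) (n := n))
  have h0 := tendsto_one_div_add_atTop_nhds_zero_nat (𝕜 := ℝ)
  obtain ⟨x, hx⟩ := S.left_complete u fun ε hε => by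
    obtain ⟨n₀, hn₀⟩ := eventually_atTop.mp (h0.eventually (eventually_lt_nhds (half_pos hε)))
    refine ⟨n₀, fun m hm n hn => ?_⟩
    refine (sqrt_norm_left_le (C := 1 / ((m : ℝ) + 1) + 1 / ((n : ℝ) + 1)) (by positivity)
      fun p => ?_).trans_lt (by linarith [hn₀ m hm, hn₀ n hn])
    rw [gelfand_sub, ← sub_sub_sub_cancel_right _ _ (σ p)]
    exact (norm_sub_le _ _).trans (add_le_add (hu m p) (hu n p))
  refine ⟨x, Subtype.ext (funext fun p => ?_)⟩
  change S.gelfand x p = σ p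
  refine eq_of_forall_dist_le fun ε hε => ?_
  obtain ⟨n₀, hn₀⟩ := eventually_atTop.mp (h0.eventually (eventually_lt_nhds (half_pos hε)))
  obtain ⟨n₁, hn₁⟩ := hx (ε / 2) (half_pos hε)
  set n := max n₀ n₁
  have h1 := (norm_gelfand_le (u n - x) p).trans_lt (hn₁ n (le_max_right _ _))
  have h2 := (hu n p).trans_lt (hn₀ n (le_max_left _ _))
  rw [gelfand_sub, norm_sub_rev] at h1
  rw [dist_eq_norm]
  calc _ ≤ _ := norm_sub_le_norm_sub_add_norm_sub _ (S.gelfand (u n) p) _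
    _ ≤ ε := by linarith

variable (S) in
/-- The Gel'fand transform as a linear equivalence. -/
def gelfandEquiv : M ≃ₗ[ℂ] S.sections₀ :=
  LinearEquiv.ofBijective S.gelfandMap ⟨gelfand_injective, gelfand_surjective_sections₀⟩

lemma gelfandEquiv_smul_left (a : A) (x : M) :
    S.gelfandEquiv (a • x) = a • S.gelfandEquiv x :=
  Subtype.ext (funext fun p => gelfand_smul_left a x p)

lemma gelfandEquiv_smul_right (b : B) (x : M) :
    S.gelfandEquiv (MulOpposite.op b • x) = MulOpposite.op b • S.gelfandEquiv x :=
  Subtype.ext (funext fun p => gelfand_smul_right b x p)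

/-! ### Transporting the inner products to sections -/

/-- An isomorphism of bimodules carries over completeness. -/
lemma isSeqComplete_comp_equiv {E F : Type*} [AddCommGroup E] [AddCommGroup F] {n : E → ℝ}
    (h : IsSeqComplete n) (e : F ≃+ E) : IsSeqComplete fun x => n (e x) := by
  intro u hu
  obtain ⟨x, hx⟩ := h (e ∘ u) (by simpa only [map_sub, Function.comp_apply] using hu)
  refine ⟨e.symm x, ?_⟩
  simpa only [map_sub, Function.comp_apply, AddEquiv.apply_symm_apply] using hx

section Transport

variable [AddCommGroup N] [Module ℂ N] [Module A N] [Module Bᵐᵒᵖ N]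
  [IsScalarTower ℂ A N] [IsScalarTower ℂ Bᵐᵒᵖ N] [SMulCommClass A Bᵐᵒᵖ N]

variable (S) in
/-- The inner products transported along a bimodule isomorphism. -/
def transport (e : N ≃ₗ[ℂ] M) (hA : ∀ (a : A) x, e (a • x) = a • e x)
    (hB : ∀ (b : B) x, e (MulOpposite.op b • x) = MulOpposite.op b • e x) :
    ImprimitivityBimodule A B N where
  left x y := S.left (e x) (e y)
  left_add x y z := by rw [map_add, S.left_add]
  left_smul a x y := by rw [hA, S.left_smul]
  left_star x y := S.left_star _ _
  left_nonneg x := S.left_nonneg _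
  left_definite x h := e.map_eq_zero_iff.mp (S.left_definite _ h)
  right x y := S.right (e x) (e y)
  right_add x y z := by rw [map_add, S.right_add]
  right_smul b x y := by rw [hB, S.right_smul]
  right_star x y := S.right_star _ _
  right_nonneg x := S.right_nonneg _
  right_definite x h := e.map_eq_zero_iff.mp (S.right_definite _ h)
  imprimitivity x y z := e.injective (by rw [hA, hB, S.imprimitivity])
  left_complete := isSeqComplete_comp_equiv S.left_complete e.toAddEquiv
  right_complete := isSeqComplete_comp_equiv S.right_complete e.toAddEquiv

end Transport

variable (S) in
/-- The bimodule of the continuous sections vanishing at infinity. -/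
def sectionsBimodule : ImprimitivityBimodule A B S.sections₀ :=
  S.transport S.gelfandEquiv.symm
    (fun a σ => S.gelfandEquiv.injective (by
      rw [gelfandEquiv_smul_left, LinearEquiv.apply_symm_apply, LinearEquiv.apply_symm_apply]))
    (fun b σ => S.gelfandEquiv.injective (by
      rw [gelfandEquiv_smul_right, LinearEquiv.apply_symm_apply, LinearEquiv.apply_symm_apply]))

variable (S) in
/-- The Gel'fand transform as an isomorphism of bimodules. -/
def gelfandIso : S.Iso S.sectionsBimodule where
  toLinearEquiv := S.gelfandEquiv
  map_left_smul := gelfandEquiv_smul_left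
  map_right_smul := gelfandEquiv_smul_right
  left_map x y := congrArg₂ S.left (S.gelfandEquiv.symm_apply_apply x)
    (S.gelfandEquiv.symm_apply_apply y)
  right_map x y := congrArg₂ S.right (S.gelfandEquiv.symm_apply_apply x)
    (S.gelfandEquiv.symm_apply_apply y)

/-- Every section is a transform, so the transported inner product is the pointwise one. -/
lemma character_sectionsBimodule_left (σ τ : S.sections₀) (p : S.graph) :
    p.1.1 (S.sectionsBimodule.left σ τ) = ⟪τ.1 p, σ.1 p⟫_ℂ := by
  obtain ⟨x, rfl⟩ := S.gelfandEquiv.surjective σ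
  obtain ⟨y, rfl⟩ := S.gelfandEquiv.surjective τ
  exact congrArg p.1.1 (S.gelfandIso.left_map x y)

lemma character_sectionsBimodule_right (σ τ : S.sections₀) (p : S.graph) :
    p.1.2 (S.sectionsBimodule.right σ τ) = ⟪σ.1 p, τ.1 p⟫_ℂ := by
  obtain ⟨x, rfl⟩ := S.gelfandEquiv.surjective σ
  obtain ⟨y, rfl⟩ := S.gelfandEquiv.surjective τ
  exact (congrArg p.1.2 (S.gelfandIso.right_map x y)).trans (character_right_eq p x y)

end ImprimitivityBimodule

end

theorem mainTheorem4 {A B M : Type*}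
    [CommCStarAlgebra A] [PartialOrder A] [StarOrderedRing A]
    [CommCStarAlgebra B] [PartialOrder B] [StarOrderedRing B]
    [AddCommGroup M] [Module ℂ M] [Module A M] [Module Bᵐᵒᵖ M]
    [IsScalarTower ℂ A M] [IsScalarTower ℂ Bᵐᵒᵖ M] [SMulCommClass A Bᵐᵒᵖ M]
    (S : ImprimitivityBimodule A B M) :
    -- the base is the graph of a homeomorphism between open subsets of the spectra
    (∃ (U : Set (WeakDual.characterSpace ℂ A)) (V : Set (WeakDual.characterSpace ℂ B))
      (h : U ≃ₜ V), IsOpen U ∧ IsOpen V ∧ S.graph = Set.range fun u : U => (u.1, (h u).1)) ∧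
    LocallyCompactSpace S.graph ∧ T2Space S.graph ∧
    -- over it there is a complex line bundle with continuous norm
    (∃ _ : FiberBundle ℂ S.Fiber, VectorBundle ℂ ℂ S.Fiber) ∧
    Continuous (fun e : Bundle.TotalSpace ℂ S.Fiber => ‖e.snd‖) ∧
    -- its sections vanishing at infinity form an imprimitivity bimodule `T`, with the pointwise
    -- inner products, and the Gel'fand transform is an isomorphism from `S` to `T`
    ∃ T : ImprimitivityBimodule A B S.sections₀,
      (∀ (σ τ : S.sections₀) (p : S.graph), p.1.1 (T.left σ τ) = inner ℂ (τ.1 p) (σ.1 p)) ∧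
      (∀ (σ τ : S.sections₀) (χ : WeakDual.characterSpace ℂ A),
        (∀ p : S.graph, p.1.1 ≠ χ) → χ (T.left σ τ) = 0) ∧
      (∀ (σ τ : S.sections₀) (p : S.graph), p.1.2 (T.right σ τ) = inner ℂ (σ.1 p) (τ.1 p)) ∧
      (∀ (σ τ : S.sections₀) (ψ : WeakDual.characterSpace ℂ B),
        (∀ p : S.graph, p.1.2 ≠ ψ) → ψ (T.right σ τ) = 0) ∧
      ∃ Φ : S.Iso T, ∀ (x : M) (p : S.graph), (Φ.toLinearEquiv x).1 p = S.gelfand x p :=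
  ⟨S.exists_homeomorph_graph, S.locallyCompactSpace_graph, inferInstance,
    ⟨S.fiberBundle, S.vectorBundle⟩, ImprimitivityBimodule.continuous_norm_snd,
    S.sectionsBimodule, ImprimitivityBimodule.character_sectionsBimodule_left,
    fun _ _ _ h => S.character_left_eq_zero h _ _,
    ImprimitivityBimodule.character_sectionsBimodule_right,
    fun _ _ _ h => S.character_right_eq_zero h _ _, S.gelfandIso, fun _ _ => rfl⟩
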